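/- Let $(\Omega,\mathcal A,\mathbb P)$ be a standard Borel probability space, $\mathcal B\subset\mathcal A$ a sub-$\sigma$-algebra, and $(M,d)$ a (non-empty) global NPC space, i.e. a complete metric space such that for all $x_0,x_1\in M$ there is $y\in M$ with $d^2(z,y)\le\frac12d^2(z,x_0)+\frac12d^2(z,x_1)-\frac14d^2(x_0,x_1)$ for all $z\in M$. For $1\le p\le\infty$ let $L^p(\Omega;M)=L^p(\Omega,\mathcal A,\mathbb P;M)$ be the set of strongly measurable $\varphi:\Omega\to M$ (modulo a.e. equality) such that $\omega\mapsto d(x,\varphi(\omega))$ lies in $L^p(\mathbb P)$ for some $x\in M$, with the metric $\mathbf d_p(\varphi,\psi)=\|d(\varphi(\cdot),\psi(\cdot))\|_{L^p(\mathbb P)}$; let $L^p(\Omega,\mathcal B,\mathbb P;M)$ be its subset of classes of $\mathcal B$-strongly measurable maps. Let $\mathcal P^1(M)$ be the set of Borel probability measures $\mu$ on $M$ that are concentrated on their support and satisfy $\int_M d(x,y)\,d\mu(y)<\infty$ for some $x\in M$. The canonical barycentric map $\lambda:\mathcal P^1(M)\to M$ is $$\lambda(\mu)=\operatorname*{arg\,min}_{z\in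 M}\int_M\bigl[d^2(z,x)-d^2(y,x)\bigr]\,d\mu(x),$$ independently of $y\in M$. Let $(\mathbb P_\omega)_{\omega\in\Omega}$ be the disintegration (regular conditional probability) of $\mathbb P$ with respect to $\mathcal B$, and for $\varphi\in L^1(\Omega;M)$ put $E^\lambda_{\mathcal B}(\varphi)(\omega)=\lambda(\varphi_*\mathbb P_\omega)$. Sturm's conditional expectation $\mathbb E_{\mathcal B}:L^1(\Omega;M)\to L^1(\Omega,\mathcal B,\mathbb P;M)$ is the $\mathbf d_1$-continuous extension to $L^1(\Omega;M)$ of the map $$\mathbb E_{\mathcal B}(\varphi)=\operatorname*{arg\,min}_{\psi\in L^2(\Omega,\mathcal B,\mathbb P;M)}\mathbf d_2(\varphi,\psi),\qquad\varphi\in L^2(\Omega;M).$$ Then $\lambda$ is well defined on $\mathcal P^1(M)$ (the minimizer exists and is unique), and $\mathbb E_{\mathcal B}$ is well defined on $L^1(\Omega;M)$ (it exists and is unique up to a.e. equality). Moreover, for every $p\in[1,\infty]$ and every $\varphi\in L^p(\Omega;M)$, one has $\varphi_*\mathbb P_\omega\in\mathcal P^1(M)$ for $\mathbb P$-a.e.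 $\omega$, $E^\lambda_{\mathcal B}(\varphi)\in L^p(\Omega,\mathcal B,\mathbb P;M)$, and $$\mathbb E_{\mathcal B}(\varphi)=E^\lambda_{\mathcal B}(\varphi)\quad\mathbb P\text{-a.e.}$$ -/

import Mathlib

open MeasureTheory ProbabilityTheory Filter Topology
open scoped ENNReal

/-- A global NPC space (CAT(0) or Hadamard space): a complete metric space in which any two points
`x₀, x₁` have a point `y` with
`d²(z, y) ≤ ½ d²(z, x₀) + ½ d²(z, x₁) - ¼ d²(x₀, x₁)` for all `z`. -/
structure IsGlobalNPC (M : Type*) [MetricSpace M] : Prop where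
  complete : CompleteSpace M
  exists_midpoint : ∀ x₀ x₁ : M, ∃ y : M, ∀ z : M,
    dist z y ^ 2 ≤ (1 / 2) * dist z x₀ ^ 2 + (1 / 2) * dist z x₁ ^ 2 - (1 / 4) * dist x₀ x₁ ^ 2

/-- `𝒫¹(M)`: Borel probability measures, concentrated on their support, with finite first
moment. -/
structure MemP1 {M : Type*} [MetricSpace M] [MeasurableSpace M] (μ : Measure M) : Prop where
  prob : IsProbabilityMeasure μ
  full_support : μ μ.supportᶜ = 0
  integrable_dist : ∃ x : M, Integrable (fun y => dist x y) μ

/-- `z` minimizes `z ↦ ∫ [d²(z, x) - d²(y, x)] dμ(x)`, for every base point `y`. -/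
def IsCanonicalBarycenter {M : Type*} [MetricSpace M] [MeasurableSpace M]
    (μ : Measure M) (z : M) : Prop :=
  ∀ y z' : M, ∫ x, (dist z x ^ 2 - dist y x ^ 2) ∂μ ≤ ∫ x, (dist z' x ^ 2 - dist y x ^ 2) ∂μ

/-- The canonical barycentric map `λ`: the minimizer above (arbitrary where there is none). -/
noncomputable def canonicalBarycenter {M : Type*} [MetricSpace M] [MeasurableSpace M] [Nonempty M]
    (μ : Measure M) : M :=
  Classical.epsilon (IsCanonicalBarycenter μ)

/-- The distance `𝐝_p(φ, ψ)`: the `L^p`-norm of `ω ↦ d(φ ω, ψ ω)`, with values in `[0, ∞]`. -/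
noncomputable def distLp {Ω M : Type*} [MeasurableSpace Ω] [MetricSpace M]
    (p : ℝ≥0∞) (P : Measure Ω) (φ ψ : Ω → M) : ℝ≥0∞ :=
  eLpNorm (fun ω => dist (φ ω) (ψ ω)) p P

/-- `φ ∈ L^p(Ω, 𝓑, P; M)`: up to a `P`-null set, `φ` is `𝓑`-strongly measurable, and
`ω ↦ d(x, φ ω)` has finite `L^p`-norm for some `x`. Functions are not yet identified when they
agree almost everywhere. -/
def MemLpMetric {Ω M : Type*} (𝓑 : MeasurableSpace Ω) [mΩ : MeasurableSpace Ω] [MetricSpace M]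
    (p : ℝ≥0∞) (P : Measure[mΩ] Ω) (φ : Ω → M) : Prop :=
  AEStronglyMeasurable[𝓑] φ P ∧ ∃ x : M, distLp p P (fun _ => x) φ < ∞

/-- `E` is Sturm's conditional expectation given `𝓑`: it maps `L¹(Ω, P; M)` to `L¹(Ω, 𝓑, P; M)`,
is `𝐝₁`-continuous there, and maps each `φ ∈ L²(Ω, P; M)` to a point of `L²(Ω, 𝓑, P; M)` at minimal
`𝐝₂`-distance from `φ`. -/
structure IsSturmCondExp {Ω M : Type*} (𝓑 : MeasurableSpace Ω) [mΩ : MeasurableSpace Ω]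
    [MetricSpace M] (P : Measure[mΩ] Ω) (E : (Ω → M) → (Ω → M)) : Prop where
  mapsTo : ∀ φ : Ω → M, MemLpMetric mΩ 1 P φ → MemLpMetric 𝓑 1 P (E φ)
  continuous : ∀ (φ : Ω → M) (φs : ℕ → Ω → M), MemLpMetric mΩ 1 P φ →
    (∀ k, MemLpMetric mΩ 1 P (φs k)) →
    Tendsto (fun k => distLp 1 P (φs k) φ) atTop (𝓝 0) →
    Tendsto (fun k => distLp 1 P (E (φs k)) (E φ)) atTop (𝓝 0)
  argmin : ∀ φ : Ω → M, MemLpMetric mΩ 2 P φ → MemLpMetric 𝓑 2 P (E φ) ∧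
    ∀ ψ : Ω → M, MemLpMetric 𝓑 2 P ψ → distLp 2 P φ (E φ) ≤ distLp 2 P φ ψ

/-- Sturm's conditional expectation `𝔼_𝓑` (arbitrary where there is none). -/
noncomputable def sturmCondExp {Ω M : Type*} (𝓑 : MeasurableSpace Ω) [mΩ : MeasurableSpace Ω]
    [MetricSpace M] (P : Measure[mΩ] Ω) : (Ω → M) → (Ω → M) :=
  @Classical.epsilon ((Ω → M) → (Ω → M)) ⟨id⟩ (IsSturmCondExp 𝓑 P)

/-- The conditional expectation `E^λ_𝓑(φ)(ω) = λ(φ_* P_ω)`, where `(P_ω)` is the disintegration of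
`P` with respect to `𝓑`, i.e. the regular conditional probability given `𝓑`. -/
noncomputable def barycentricCondExp {Ω M : Type*} (𝓑 : MeasurableSpace Ω)
    [mΩ : MeasurableSpace Ω] [StandardBorelSpace Ω] [MetricSpace M] [MeasurableSpace M] [Nonempty M]
    (P : Measure[mΩ] Ω) [IsFiniteMeasure P] (φ : Ω → M) : Ω → M :=
  fun ω => canonicalBarycenter (Measure.map φ (condExpKernel P 𝓑 ω))

/-! Uniform convexity of `z ↦ ∫ d²(z, x) dμ(x)` gives the variance inequality
`d²(λ(μ), z) ≤ ∫ [d²(z, x) - d²(λ(μ), x)] dμ(x)`. Adding it for the laws `f_* Q` and `g_* Q`, each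
tested at the barycenter of the other, and applying Reshetnyak's quadrilateral comparison pointwise
yields `d(λ(f_* Q), λ(g_* Q)) ≤ ∫ d(f, g) dQ`.

With `Q = P_ω` this bounds `d(E^λ_𝓑(φ), E^λ_𝓑(ψ))` by the conditional expectation of `d(φ, ψ)`, so
`E^λ_𝓑` is `1`-Lipschitz for every `𝐝_p`. Since `𝓑`-measurable maps are a.e. constant under `P_ω`,
integrating the variance inequality gives
`𝐝₂²(E^λ_𝓑(φ), ψ) + 𝐝₂²(φ, E^λ_𝓑(φ)) ≤ 𝐝₂²(φ, ψ)` for `𝓑`-measurable `ψ`. Hence `E^λ_𝓑` is the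
unique `L²` projection and, simple functions being dense, its only continuous extension to `L¹`.

`E^λ_𝓑(φ)` is `𝓑`-measurable for simple `φ` because barycenters of laws on a fixed finite set depend
Lipschitz-continuously on the weights; the `L¹` contraction passes this to the limit. -/

section Geometry

variable {M : Type*} [MetricSpace M]

theorem mul_sq_dist_le_add_sq_dist {s t : ℝ} (hs : 0 ≤ s) (ht : 0 ≤ t) (hst : s + t = 1)
    (x y m : M) : s * t * dist x y ^ 2 ≤ s * dist x m ^ 2 + t * dist y m ^ 2 := by
  have triangle : dist x y ^ 2 ≤ (dist x m + dist y m) ^ 2 :=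
    pow_le_pow_left₀ dist_nonneg (dist_triangle_right x y m) 2
  obtain rfl : s = 1 - t := by linarith
  linarith [mul_le_mul_of_nonneg_left triangle (mul_nonneg hs ht),
    sq_nonneg ((1 - t) * dist x m - t * dist y m)]

/-- `m` is a midpoint of `x` and `y` in the sense of non-positive curvature, as provided by
`IsGlobalNPC.exists_midpoint`. -/
def IsNPCMidpoint (x y m : M) : Prop :=
  ∀ z : M, dist z m ^ 2 ≤
    (1 / 2) * dist z x ^ 2 + (1 / 2) * dist z y ^ 2 - (1 / 4) * dist x y ^ 2

theorem IsNPCMidpoint.dist_right_le {x y m : M} (h : IsNPCMidpoint x y m) :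
    dist y m ≤ dist x y / 2 := by
  have hy := h y
  rw [dist_self, dist_comm y x] at hy
  nlinarith [dist_nonneg (x := y) (y := m), dist_nonneg (x := x) (y := y)]

/-- Uniform convexity with the modulus of a squared distance, tested at midpoints only. In a global
NPC space such functions have unique minimizers; barycenters are obtained in this way. -/
def IsUniformlyMidconvex (F : M → ℝ) : Prop :=
  ∀ x y m : M, IsNPCMidpoint x y m →
    F m ≤ (1 / 2) * F x + (1 / 2) * F y - (1 / 4) * dist x y ^ 2

namespace IsUniformlyMidconvex

variable {F G : M → ℝ}

theorem sq_dist (x : M) : IsUniformlyMidconvex fun z => dist x z ^ 2 :=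
  fun _ _ _ hm => hm x

theorem sub_const (hF : IsUniformlyMidconvex F) (c : ℝ) :
    IsUniformlyMidconvex fun z => F z - c := by
  intro x y m hm
  linarith [hF x y m hm]

theorem convex_combination (hF : IsUniformlyMidconvex F) (hG : IsUniformlyMidconvex G) {s t : ℝ}
    (hs : 0 ≤ s) (ht : 0 ≤ t) (hst : s + t = 1) :
    IsUniformlyMidconvex fun z => s * F z + t * G z := by
  intro x y m hm
  obtain rfl : s = 1 - t := by linarith
  linarith [mul_le_mul_of_nonneg_left (hF x y m hm) hs,
    mul_le_mul_of_nonneg_left (hG x y m hm) ht]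

theorem integral {α : Type*} [MeasurableSpace α] {μ : Measure α} [IsProbabilityMeasure μ]
    {F : α → M → ℝ} (hF : ∀ a, IsUniformlyMidconvex (F a))
    (hi : ∀ z, Integrable (fun a => F a z) μ) : IsUniformlyMidconvex fun z => ∫ a, F a z ∂μ := by
  intro x y m hm
  have hsum : Integrable (fun a => (1 / 2) * F a x + (1 / 2) * F a y) μ :=
    ((hi x).const_mul _).add ((hi y).const_mul _)
  calc ∫ a, F a m ∂μ
      ≤ ∫ a, ((1 / 2) * F a x + (1 / 2) * F a y - (1 / 4) * dist x y ^ 2) ∂μ :=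
        integral_mono (hi m) (hsum.sub (integrable_const _)) fun a => hF a x y m hm
    _ = (1 / 2) * ∫ a, F a x ∂μ + (1 / 2) * ∫ a, F a y ∂μ - (1 / 4) * dist x y ^ 2 := by
        rw [integral_sub hsum (integrable_const _),
          integral_add ((hi x).const_mul _) ((hi y).const_mul _), integral_const_mul,
          integral_const_mul, integral_const, probReal_univ, one_smul]

theorem one_sub_half_pow_mul_sq_dist_le (hM : IsGlobalNPC M) (hF : IsUniformlyMidconvex F) {a : M}
    (ha : ∀ z, F a ≤ F z) (n : ℕ) (z : M) :
    (1 - (1 / 2) ^ n) * dist a z ^ 2 ≤ F z - F a := by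
  induction n generalizing z with
  | zero => simpa using ha z
  | succ n ih =>
    obtain ⟨m, hm : IsNPCMidpoint a z m⟩ := hM.exists_midpoint a z
    have half_le : dist a z / 2 ≤ dist a m := by
      linarith [dist_triangle_right a z m, hm.dist_right_le]
    have quarter_le : dist a z ^ 2 / 4 ≤ dist a m ^ 2 := by
      nlinarith [dist_nonneg (x := a) (y := z)]
    have coeff_nonneg : (0 : ℝ) ≤ 1 - (1 / 2) ^ n :=
      sub_nonneg.2 (pow_le_one₀ (by norm_num) (by norm_num))
    rw [pow_succ]
    linarith [hF a z m hm, ih m, mul_le_mul_of_nonneg_left quarter_le coeff_nonneg]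

theorem sq_dist_le_of_forall_le (hM : IsGlobalNPC M) (hF : IsUniformlyMidconvex F) {a : M}
    (ha : ∀ z, F a ≤ F z) (z : M) : dist a z ^ 2 ≤ F z - F a := by
  have hlim : Tendsto (fun n : ℕ => (1 - (1 / 2 : ℝ) ^ n) * dist a z ^ 2) atTop
      (𝓝 ((1 - 0) * dist a z ^ 2)) :=
    (tendsto_const_nhds.sub (tendsto_pow_atTop_nhds_zero_of_lt_one (by norm_num)
      (by norm_num))).mul tendsto_const_nhds
  simpa using le_of_tendsto' hlim fun n => one_sub_half_pow_mul_sq_dist_le hM hF ha n z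

theorem cauchySeq_of_tendsto (hM : IsGlobalNPC M) (hF : IsUniformlyMidconvex F) {I : ℝ}
    (hI : ∀ z, I ≤ F z) {u : ℕ → M} (hu : Tendsto (fun n => F (u n)) atTop (𝓝 I)) :
    CauchySeq u := by
  have sq_dist_le (x y : M) : dist x y ^ 2 ≤ 2 * (F x - I) + 2 * (F y - I) := by
    obtain ⟨m, hm⟩ := hM.exists_midpoint x y
    linarith [hF x y m hm, hI m]
  refine Metric.cauchySeq_iff.2 fun ε hε => ?_
  obtain ⟨N, hN⟩ := eventually_atTop.1
    (hu.eventually (gt_mem_nhds (show I < I + ε ^ 2 / 4 by linarith [pow_pos hε 2])))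
  refine ⟨N, fun m hm n hn => lt_of_pow_lt_pow_left₀ 2 hε.le ?_⟩
  linarith [sq_dist_le (u m) (u n), hN m hm, hN n hn]

theorem exists_forall_le [Nonempty M] (hM : IsGlobalNPC M) (hF : IsUniformlyMidconvex F)
    (hlsc : LowerSemicontinuous F) (hbdd : BddBelow (Set.range F)) : ∃ a, ∀ z, F a ≤ F z := by
  have := hM.complete
  obtain ⟨v, -, hv, hvF⟩ := exists_seq_tendsto_sInf (Set.range_nonempty F) hbdd
  choose u hu using hvF
  obtain rfl : (fun n => F (u n)) = v := funext hu
  have hlow (z : M) : sInf (Set.range F) ≤ F z := csInf_le hbdd ⟨z, rfl⟩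
  obtain ⟨a, ha⟩ := cauchySeq_tendsto_of_complete (cauchySeq_of_tendsto hM hF hlow hv)
  refine ⟨a, fun z => le_trans (le_of_forall_lt fun c hc => ?_) (hlow z)⟩
  obtain ⟨d, hcd, hda⟩ := exists_between hc
  exact hcd.trans_le (ge_of_tendsto hv ((ha.eventually (hlsc a d hda)).mono fun _ => le_of_lt))

end IsUniformlyMidconvex

namespace IsGlobalNPC

theorem exists_geodesic_point (hM : IsGlobalNPC M) {s t : ℝ} (hs : 0 ≤ s) (ht : 0 ≤ t)
    (hst : s + t = 1) (x y : M) :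
    ∃ m, ∀ z, dist z m ^ 2 ≤ s * dist z x ^ 2 + t * dist z y ^ 2 - s * t * dist x y ^ 2 := by
  have : Nonempty M := ⟨x⟩
  have hF := (IsUniformlyMidconvex.sq_dist x).convex_combination (.sq_dist y) hs ht hst
  obtain ⟨m, hm⟩ := hF.exists_forall_le hM
    (Continuous.lowerSemicontinuous (by fun_prop)) ⟨0, by rintro _ ⟨z, rfl⟩; positivity⟩
  have hxy := mul_sq_dist_le_add_sq_dist hs ht hst x y m
  refine ⟨m, fun z => ?_⟩
  have variance := hF.sq_dist_le_of_forall_le hM hm z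
  simp only [dist_comm x z, dist_comm y z, dist_comm m z] at variance
  linarith

/-- Reshetnyak's quadrilateral comparison. -/
theorem sq_dist_add_sq_dist_le (hM : IsGlobalNPC M) (a b c d : M) :
    dist a d ^ 2 + dist b c ^ 2 ≤
      dist a c ^ 2 + dist b d ^ 2 + 2 * dist a b * dist c d := by
  rcases eq_or_ne a b with rfl | hne_ab
  · simp [add_comm]
  rcases eq_or_ne c d with rfl | hne_cd
  · simp
  have hab := dist_pos.2 hne_ab
  have hcd := dist_pos.2 hne_cd
  have hpos : 0 < dist a b + dist c d := add_pos hab hcd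
  -- these weights minimize `(s / t) * dist a b ^ 2 + (t / s) * dist c d ^ 2`
  obtain ⟨s, hs⟩ : ∃ s, s = dist c d / (dist a b + dist c d) := ⟨_, rfl⟩
  obtain ⟨t, ht⟩ : ∃ t, t = dist a b / (dist a b + dist c d) := ⟨_, rfl⟩
  have hs_pos : 0 < s := hs ▸ div_pos hcd hpos
  have ht_pos : 0 < t := ht ▸ div_pos hab hpos
  have hst : s + t = 1 := by rw [hs, ht]; field_simp; ring
  have optimal : s ^ 2 * dist a b ^ 2 + t ^ 2 * dist c d ^ 2 =
      s * t * (2 * dist a b * dist c d) := by rw [hs, ht]; field_simp; ring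
  obtain ⟨m, hm⟩ := hM.exists_geodesic_point hs_pos.le ht_pos.le hst b c
  have had : s * t * dist a d ^ 2 ≤ s * dist a m ^ 2 + t * dist d m ^ 2 :=
    mul_sq_dist_le_add_sq_dist hs_pos.le ht_pos.le hst a d m
  have key : s * t * (dist a d ^ 2 + dist b c ^ 2) ≤
      s * t * (dist a c ^ 2 + dist b d ^ 2 + 2 * dist a b * dist c d) := by
    have ham := mul_le_mul_of_nonneg_left (hm a) hs_pos.le
    have hdm := mul_le_mul_of_nonneg_left (hm d) ht_pos.le
    rw [dist_comm d b, dist_comm d c] at hdm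
    obtain rfl : s = 1 - t := by linarith
    linarith
  exact le_of_mul_le_mul_left key (mul_pos hs_pos ht_pos)

end IsGlobalNPC

end Geometry

section MemLpMetric

variable {Ω M : Type*} {𝓑 : MeasurableSpace Ω} [mΩ : MeasurableSpace Ω] [MetricSpace M]
  {P : Measure[mΩ] Ω} {p q : ℝ≥0∞} {φ ψ χ φ' ψ' : Ω → M}

theorem memLp_dist_of_memLp_dist [IsFiniteMeasure P] {x y : M}
    (hx : MemLp (fun ω => dist x (φ ω)) p P)
    (hy : AEStronglyMeasurable (fun ω => dist y (φ ω)) P) :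
    MemLp (fun ω => dist y (φ ω)) p P := by
  refine ((memLp_const (dist y x)).add hx).mono' hy (ae_of_all _ fun ω => ?_)
  rw [Real.norm_of_nonneg dist_nonneg]
  exact dist_triangle _ _ _

theorem distLp_one_eq_lintegral (φ ψ : Ω → M) :
    distLp 1 P φ ψ = ∫⁻ ω, edist (φ ω) (ψ ω) ∂P := by
  simp only [distLp, eLpNorm_one_eq_lintegral_enorm, Real.enorm_of_nonneg dist_nonneg, edist_dist]

theorem distLp_one_eq_ofReal_integral (h : Integrable (fun ω => dist (φ ω) (ψ ω)) P) :
    distLp 1 P φ ψ = ENNReal.ofReal (∫ ω, dist (φ ω) (ψ ω) ∂P) := by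
  rw [distLp, eLpNorm_one_eq_lintegral_enorm, ← ofReal_integral_norm_eq_lintegral_enorm h]
  simp only [Real.norm_of_nonneg dist_nonneg]

theorem distLp_two_sq (h : MemLp (fun ω => dist (φ ω) (ψ ω)) 2 P) :
    distLp 2 P φ ψ ^ 2 = ENNReal.ofReal (∫ ω, dist (φ ω) (ψ ω) ^ 2 ∂P) := by
  rw [distLp, h.eLpNorm_eq_integral_rpow_norm two_ne_zero ENNReal.ofNat_ne_top,
    ← ENNReal.ofReal_pow (by positivity), ← Real.rpow_natCast, ← Real.rpow_mul (by positivity)]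
  simp

theorem distLp_triangle (hp : 1 ≤ p) (hφ : AEStronglyMeasurable φ P)
    (hψ : AEStronglyMeasurable ψ P) (hχ : AEStronglyMeasurable χ P) :
    distLp p P φ χ ≤ distLp p P φ ψ + distLp p P ψ χ := by
  refine (eLpNorm_mono_real fun ω => ?_).trans (eLpNorm_add_le (hφ.dist hψ) (hψ.dist hχ) hp)
  rw [Real.norm_of_nonneg dist_nonneg]
  exact dist_triangle _ _ _

theorem distLp_comm (φ ψ : Ω → M) : distLp p P φ ψ = distLp p P ψ φ := by
  simp only [distLp, dist_comm]

theorem distLp_congr_ae (hφ : φ =ᵐ[P] φ') (hψ : ψ =ᵐ[P] ψ') :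
    distLp p P φ ψ = distLp p P φ' ψ' :=
  eLpNorm_congr_ae (hφ.comp₂ dist hψ)

theorem ae_eq_of_distLp_eq_zero (hp : p ≠ 0) (hφ : AEStronglyMeasurable φ P)
    (hψ : AEStronglyMeasurable ψ P) (h : distLp p P φ ψ = 0) : φ =ᵐ[P] ψ := by
  rw [distLp, eLpNorm_eq_zero_iff (hφ.dist hψ) hp] at h
  filter_upwards [h] with ω hω using dist_eq_zero.1 hω

namespace MemLpMetric

theorem of_le (h : MemLpMetric 𝓑 p P φ) (h𝓑 : 𝓑 ≤ mΩ) :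
    MemLpMetric mΩ p P φ :=
  ⟨h.1.mono h𝓑, h.2⟩

theorem congr_ae (h : MemLpMetric 𝓑 p P φ) (hφψ : φ =ᵐ[P] ψ) :
    MemLpMetric 𝓑 p P ψ := by
  obtain ⟨hm, x, hx⟩ := h
  exact ⟨hm.congr hφψ, x, (distLp_congr_ae ae_eq_rfl hφψ.symm).trans_lt hx⟩

theorem memLp_dist_const [IsFiniteMeasure P] (h : MemLpMetric mΩ p P φ) (y : M) :
    MemLp (fun ω => dist y (φ ω)) p P := by
  obtain ⟨hm, x, hx⟩ := h
  exact memLp_dist_of_memLp_dist ⟨aestronglyMeasurable_const.dist hm, hx⟩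
    (aestronglyMeasurable_const.dist hm)

theorem memLp_dist [IsFiniteMeasure P] (hφ : MemLpMetric mΩ p P φ) (hψ : MemLpMetric mΩ p P ψ) :
    MemLp (fun ω => dist (φ ω) (ψ ω)) p P := by
  obtain ⟨x, -⟩ := hφ.2
  refine ((hφ.memLp_dist_const x).add (hψ.memLp_dist_const x)).mono' (hφ.1.dist hψ.1)
    (ae_of_all _ fun ω => ?_)
  rw [Real.norm_of_nonneg dist_nonneg]
  exact dist_triangle_left _ _ _

theorem integrable_dist_const [IsFiniteMeasure P] (h : MemLpMetric mΩ 1 P φ) (y : M) :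
    Integrable (fun ω => dist y (φ ω)) P :=
  memLp_one_iff_integrable.1 (h.memLp_dist_const y)

theorem integrable_dist [IsFiniteMeasure P] (hφ : MemLpMetric mΩ 1 P φ)
    (hψ : MemLpMetric mΩ 1 P ψ) : Integrable (fun ω => dist (φ ω) (ψ ω)) P :=
  memLp_one_iff_integrable.1 (hφ.memLp_dist hψ)

theorem mono_exponent [IsFiniteMeasure P] (h : MemLpMetric mΩ q P φ) (hpq : p ≤ q) :
    MemLpMetric mΩ p P φ := by
  obtain ⟨x, -⟩ := h.2
  exact ⟨h.1, x, ((h.memLp_dist_const x).mono_exponent hpq).2⟩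

end MemLpMetric

theorem memLpMetric_const [IsFiniteMeasure P] (x : M) :
    MemLpMetric 𝓑 p P fun _ => x :=
  ⟨aestronglyMeasurable_const, x, by simp [distLp]⟩

variable [Nonempty M]

theorem memLpMetric_simpleFunc [IsFiniteMeasure P] (φ : SimpleFunc Ω M) :
    MemLpMetric mΩ p P φ :=
  let x := Classical.arbitrary M
  ⟨φ.stronglyMeasurable.aestronglyMeasurable, x,
    ((φ.map (dist x)).memLp_of_isFiniteMeasure p P).2⟩

theorem exists_simpleFunc_tendsto_distLp_one (hφ : StronglyMeasurable φ) :
    ∃ φs : ℕ → SimpleFunc Ω M, ∀ Q : Measure[mΩ] Ω, IsFiniteMeasure Q → MemLpMetric mΩ 1 Q φ →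
      Tendsto (fun n => distLp 1 Q (φs n) φ) atTop (𝓝 0) := by
  borelize M
  let x := Classical.arbitrary M
  let s := insert x (Set.range φ)
  have hx : x ∈ s := Set.mem_insert _ _
  have : TopologicalSpace.SeparableSpace s :=
    ((Set.countable_singleton x).isSeparable.union hφ.isSeparable_range).separableSpace
  refine ⟨SimpleFunc.approxOn φ hφ.measurable s x hx, fun Q _ hφQ => ?_⟩
  simp only [distLp_one_eq_lintegral]
  rw [← lintegral_zero (μ := Q)]
  refine tendsto_lintegral_of_dominated_convergence (fun ω => edist x (φ ω))
    (fun n => ?_) (fun n => ae_of_all _ fun ω =>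
      SimpleFunc.edist_approxOn_le hφ.measurable hx ω n) ?_ (ae_of_all _ fun ω => ?_)
  · exact ((SimpleFunc.stronglyMeasurable _).edist hφ).measurable
  · rw [← distLp_one_eq_lintegral]
    exact (hφQ.memLp_dist_const x).2.ne
  · have := SimpleFunc.tendsto_approxOn hφ.measurable hx
      (subset_closure (Set.mem_insert_of_mem x (Set.mem_range_self ω)))
    exact tendsto_iff_edist_tendsto_0.1 this

end MemLpMetric

section Barycenter

variable {M : Type*} [MetricSpace M]

theorem abs_sq_dist_sub_sq_dist_le (z y x : M) :
    |dist z x ^ 2 - dist y x ^ 2| ≤ dist z y * (dist z x + dist y x) := by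
  rw [sq_sub_sq, abs_mul, abs_of_nonneg (show 0 ≤ dist z x + dist y x by positivity), mul_comm]
  gcongr
  exact abs_dist_sub_le z y x

theorem integrable_sq_dist_sub {α : Type*} [MeasurableSpace α] {μ : Measure α} {f : α → M}
    {y z : M} (hz : Integrable (fun a => dist z (f a)) μ)
    (hy : Integrable (fun a => dist y (f a)) μ) :
    Integrable (fun a => dist z (f a) ^ 2 - dist y (f a) ^ 2) μ :=
  ((hz.add hy).const_mul (dist z y)).mono' ((hz.1.pow 2).sub (hy.1.pow 2))
    (ae_of_all _ fun a => abs_sq_dist_sub_sq_dist_le z y (f a))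

variable [MeasurableSpace M]

/-- The functional `z ↦ ∫ [d²(z, x) - d²(y, x)] dμ(x)` whose minimizer is the barycenter of `μ`;
subtracting `d²(y, x)` makes the integral converge when `μ` has only a first moment. -/
noncomputable def varianceFunctional (μ : Measure M) (y z : M) : ℝ :=
  ∫ x, (dist z x ^ 2 - dist y x ^ 2) ∂μ

theorem varianceFunctional_map {α : Type*} [MeasurableSpace α] [BorelSpace M] {μ : Measure α}
    {f : α → M} (hf : AEMeasurable f μ) (y z : M) :
    varianceFunctional (μ.map f) y z = ∫ a, (dist z (f a) ^ 2 - dist y (f a) ^ 2) ∂μ :=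
  integral_map hf (by fun_prop)

variable [OpensMeasurableSpace M] {μ : Measure M} {x₀ : M}

theorem integrable_dist_of_integrable_dist [IsFiniteMeasure μ]
    (h : Integrable (fun x => dist x₀ x) μ) (y : M) : Integrable (fun x => dist y x) μ :=
  memLp_one_iff_integrable.1 (memLp_dist_of_memLp_dist (memLp_one_iff_integrable.2 h)
    (by fun_prop))

theorem integrable_sq_dist_sub_of_integrable_dist [IsFiniteMeasure μ]
    (h : Integrable (fun x => dist x₀ x) μ) (z y : M) :
    Integrable (fun x => dist z x ^ 2 - dist y x ^ 2) μ :=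
  integrable_sq_dist_sub (integrable_dist_of_integrable_dist h z)
    (integrable_dist_of_integrable_dist h y)

theorem varianceFunctional_sub [IsFiniteMeasure μ] (h : Integrable (fun x => dist x₀ x) μ)
    (y z w : M) :
    varianceFunctional μ y z - varianceFunctional μ y w = varianceFunctional μ w z := by
  simp only [varianceFunctional]
  rw [← integral_sub (integrable_sq_dist_sub_of_integrable_dist h z y)
    (integrable_sq_dist_sub_of_integrable_dist h w y)]
  simp only [sub_sub_sub_cancel_right]

theorem abs_varianceFunctional_le [IsFiniteMeasure μ] (h : Integrable (fun x => dist x₀ x) μ)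
    (w z : M) :
    |varianceFunctional μ w z| ≤ dist z w * ∫ x, (dist z w + 2 * dist w x) ∂μ := by
  have hw := integrable_dist_of_integrable_dist h w
  rw [← Real.norm_eq_abs, ← integral_const_mul]
  refine norm_integral_le_of_norm_le (((integrable_const _).add (hw.const_mul 2)).const_mul _)
    (ae_of_all _ fun x => (abs_sq_dist_sub_sq_dist_le z w x).trans
      (mul_le_mul_of_nonneg_left ?_ dist_nonneg))
  linarith [dist_triangle z w x]

theorem continuous_varianceFunctional [IsFiniteMeasure μ]
    (h : Integrable (fun x => dist x₀ x) μ) (y : M) : Continuous (varianceFunctional μ y) := by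
  refine continuous_iff_continuousAt.2 fun w => tendsto_iff_dist_tendsto_zero.2 ?_
  have hw := integrable_dist_of_integrable_dist h w
  refine squeeze_zero (fun _ => dist_nonneg) (fun z => ?_) (?_ : Tendsto
    (fun z => dist z w * (μ.real Set.univ * dist z w + 2 * ∫ x, dist w x ∂μ)) _ _)
  · rw [Real.dist_eq, varianceFunctional_sub h]
    refine (abs_varianceFunctional_le h w z).trans_eq ?_
    rw [integral_add (integrable_const _) (hw.const_mul 2), integral_const_mul, integral_const,
      smul_eq_mul]
  · exact (Continuous.tendsto (by fun_prop) w).trans_eq (by simp)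

theorem bddBelow_range_varianceFunctional [IsProbabilityMeasure μ]
    (h : Integrable (fun x => dist x₀ x) μ) (y : M) :
    BddBelow (Set.range (varianceFunctional μ y)) := by
  have hy := integrable_dist_of_integrable_dist h y
  refine ⟨-(∫ x, dist y x ∂μ) ^ 2, ?_⟩
  rintro _ ⟨z, rfl⟩
  have reverse_triangle (x : M) : (dist z y - dist y x) ^ 2 ≤ dist z x ^ 2 := by
    rw [dist_comm y x]
    exact sq_le_sq.2 ((abs_dist_sub_le z x y).trans (le_abs_self _))
  calc -(∫ x, dist y x ∂μ) ^ 2 ≤ dist z y ^ 2 - 2 * dist z y * ∫ x, dist y x ∂μ := by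
        linarith [sq_nonneg (dist z y - ∫ x, dist y x ∂μ)]
    _ = ∫ x, (dist z y ^ 2 - 2 * dist z y * dist y x) ∂μ := by
        rw [integral_sub (integrable_const _) (hy.const_mul _), integral_const_mul,
          integral_const, probReal_univ, one_smul]
    _ ≤ varianceFunctional μ y z :=
        integral_mono ((integrable_const _).sub (hy.const_mul _))
          (integrable_sq_dist_sub_of_integrable_dist h z y) fun x => by
            linarith [reverse_triangle x]

theorem isUniformlyMidconvex_varianceFunctional [IsProbabilityMeasure μ]
    (h : Integrable (fun x => dist x₀ x) μ) (y : M) :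
    IsUniformlyMidconvex (varianceFunctional μ y) :=
  .integral (fun x => by
    simpa only [dist_comm x] using (IsUniformlyMidconvex.sq_dist x).sub_const (dist y x ^ 2))
    fun z => integrable_sq_dist_sub_of_integrable_dist h z y

theorem IsCanonicalBarycenter.sq_dist_le (hM : IsGlobalNPC M) [IsProbabilityMeasure μ]
    (h : Integrable (fun x => dist x₀ x) μ) {a : M} (ha : IsCanonicalBarycenter μ a) (z : M) :
    dist a z ^ 2 ≤ varianceFunctional μ a z := by
  rw [← varianceFunctional_sub h a z a]
  exact (isUniformlyMidconvex_varianceFunctional h a).sq_dist_le_of_forall_le hM (ha a) z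

variable [Nonempty M]

theorem existsUnique_isCanonicalBarycenter (hM : IsGlobalNPC M) [IsProbabilityMeasure μ]
    (h : Integrable (fun x => dist x₀ x) μ) : ∃! z : M, IsCanonicalBarycenter μ z := by
  obtain ⟨a, ha⟩ := (isUniformlyMidconvex_varianceFunctional h x₀).exists_forall_le hM
    (continuous_varianceFunctional h x₀).lowerSemicontinuous
    (bddBelow_range_varianceFunctional h x₀)
  have hbary : IsCanonicalBarycenter μ a := fun y z => by
    change varianceFunctional μ y a ≤ varianceFunctional μ y z
    rw [← sub_nonneg, varianceFunctional_sub h, ← varianceFunctional_sub h x₀, sub_nonneg]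
    exact ha z
  refine ⟨a, hbary, fun b hb => ?_⟩
  have hab : dist a b ^ 2 ≤ 0 := calc
    dist a b ^ 2 ≤ varianceFunctional μ a b := hbary.sq_dist_le hM h b
    _ ≤ varianceFunctional μ a a := hb a a
    _ = 0 := by simp [varianceFunctional]
  exact (dist_le_zero.1 (sq_nonpos_iff _ |>.1 hab).le).symm

theorem isCanonicalBarycenter_canonicalBarycenter (hM : IsGlobalNPC M) [IsProbabilityMeasure μ]
    (h : Integrable (fun x => dist x₀ x) μ) : IsCanonicalBarycenter μ (canonicalBarycenter μ) :=
  Classical.epsilon_spec (existsUnique_isCanonicalBarycenter hM h).exists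

theorem canonicalBarycenter_dirac (hM : IsGlobalNPC M) (x : M) :
    canonicalBarycenter (Measure.dirac x) = x := by
  have h : Integrable (fun y => dist x y) (Measure.dirac x) := integrable_dirac (by simp)
  have hx : IsCanonicalBarycenter (Measure.dirac x) x := fun y z => by
    simp only [integral_dirac, dist_self]
    linarith [sq_nonneg (dist z x)]
  exact (existsUnique_isCanonicalBarycenter hM h).unique
    (isCanonicalBarycenter_canonicalBarycenter hM h) hx

end Barycenter

section LawBarycenter

theorem measure_compl_support_of_isSeparable {X : Type*} [PseudoMetricSpace X] [MeasurableSpace X]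
    {μ : Measure X} {s : Set X} (hs : TopologicalSpace.IsSeparable s) (hμ : ∀ᵐ x ∂μ, x ∈ s) :
    μ μ.supportᶜ = 0 := by
  have lindelof : IsLindelof (μ.supportᶜ ∩ s) := by
    have := (hs.mono (Set.inter_subset_right (s := μ.supportᶜ))).secondCountableTopology
    rw [isLindelof_iff_lindelofSpace]
    infer_instance
  have null : (μ.supportᶜ ∩ s)ᶜ ∈ ae μ := by
    refine lindelof.compl_mem_sets_of_nhdsWithin fun x hx => ?_
    obtain ⟨U, hU, hU_null⟩ := Measure.notMem_support_iff_exists.1 hx.1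
    exact ⟨U, mem_nhdsWithin_of_mem_nhds hU, compl_mem_ae_iff.2 hU_null⟩
  filter_upwards [null, hμ] with x hx hxs
  exact not_not.1 fun hx_support => hx ⟨hx_support, hxs⟩

theorem le_of_sq_le_mul {r c : ℝ} (hc : 0 ≤ c) (h : r ^ 2 ≤ r * c) : r ≤ c := by
  rcases le_or_gt r 0 with hr | hr
  · exact hr.trans hc
  · exact le_of_mul_le_mul_left (sq r ▸ h) hr

variable {Ω M : Type*} [mΩ : MeasurableSpace Ω] {Q : Measure Ω} [MetricSpace M]
  [MeasurableSpace M] [BorelSpace M] {f g : Ω → M}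

theorem MemLpMetric.integrable_dist_map [IsFiniteMeasure Q] (hf : MemLpMetric mΩ 1 Q f) (x : M) :
    Integrable (fun y => dist x y) (Q.map f) :=
  (integrable_map_measure (by fun_prop) hf.1.aemeasurable).2 (hf.integrable_dist_const x)

variable [IsProbabilityMeasure Q]

theorem MemLpMetric.memP1_map (hf : MemLpMetric mΩ 1 Q f) : MemP1 (Q.map f) where
  prob := Measure.isProbabilityMeasure_map hf.1.aemeasurable
  full_support := by
    obtain ⟨t, ht, hft⟩ := hf.1.isSeparable_ae_range
    refine measure_compl_support_of_isSeparable ht.closure ?_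
    exact (ae_map_iff hf.1.aemeasurable isClosed_closure.measurableSet).2
      (hft.mono fun _ hω => subset_closure hω)
  integrable_dist :=
    let ⟨x, _⟩ := hf.2
    ⟨x, hf.integrable_dist_map x⟩

variable [Nonempty M]

theorem MemLpMetric.sq_dist_canonicalBarycenter_map_le (hM : IsGlobalNPC M)
    (hf : MemLpMetric mΩ 1 Q f) (z : M) :
    dist (canonicalBarycenter (Q.map f)) z ^ 2 ≤
      ∫ ω, (dist z (f ω) ^ 2 - dist (canonicalBarycenter (Q.map f)) (f ω) ^ 2) ∂Q := by
  have := hf.memP1_map.prob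
  rw [← varianceFunctional_map hf.1.aemeasurable]
  exact (isCanonicalBarycenter_canonicalBarycenter hM (hf.integrable_dist_map z)).sq_dist_le hM
    (hf.integrable_dist_map z) z

theorem MemLpMetric.dist_canonicalBarycenter_map_le (hM : IsGlobalNPC M)
    (hf : MemLpMetric mΩ 1 Q f) (hg : MemLpMetric mΩ 1 Q g) :
    dist (canonicalBarycenter (Q.map f)) (canonicalBarycenter (Q.map g)) ≤
      ∫ ω, dist (f ω) (g ω) ∂Q := by
  have hvf := hf.sq_dist_canonicalBarycenter_map_le hM (canonicalBarycenter (Q.map g))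
  have hvg := hg.sq_dist_canonicalBarycenter_map_le hM (canonicalBarycenter (Q.map f))
  generalize canonicalBarycenter (Q.map f) = a at hvf hvg ⊢
  generalize canonicalBarycenter (Q.map g) = b at hvf hvg ⊢
  have hif := integrable_sq_dist_sub (hf.integrable_dist_const b) (hf.integrable_dist_const a)
  have hig := integrable_sq_dist_sub (hg.integrable_dist_const a) (hg.integrable_dist_const b)
  have hsq : 2 * dist a b ^ 2 ≤ 2 * dist a b * ∫ ω, dist (f ω) (g ω) ∂Q := calc
    2 * dist a b ^ 2 ≤ ∫ ω, (dist b (f ω) ^ 2 - dist a (f ω) ^ 2) ∂Q +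
        ∫ ω, (dist a (g ω) ^ 2 - dist b (g ω) ^ 2) ∂Q := by
      linarith [dist_comm b a ▸ hvg]
    _ = ∫ ω, (dist b (f ω) ^ 2 - dist a (f ω) ^ 2 +
        (dist a (g ω) ^ 2 - dist b (g ω) ^ 2)) ∂Q := (integral_add hif hig).symm
    _ ≤ ∫ ω, 2 * dist a b * dist (f ω) (g ω) ∂Q :=
      integral_mono (hif.add hig) ((hf.integrable_dist hg).const_mul _) fun ω => by
        dsimp only
        linarith [hM.sq_dist_add_sq_dist_le a b (f ω) (g ω)]
    _ = 2 * dist a b * ∫ ω, dist (f ω) (g ω) ∂Q := integral_const_mul _ _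
  exact le_of_sq_le_mul (integral_nonneg fun _ => dist_nonneg) (by linarith)

theorem MemLpMetric.edist_canonicalBarycenter_map_le (hM : IsGlobalNPC M)
    (hf : MemLpMetric mΩ 1 Q f) (hg : MemLpMetric mΩ 1 Q g) :
    edist (canonicalBarycenter (Q.map f)) (canonicalBarycenter (Q.map g)) ≤ distLp 1 Q f g := by
  rw [edist_dist, distLp_one_eq_ofReal_integral (hf.integrable_dist hg)]
  exact ENNReal.ofReal_le_ofReal (hf.dist_canonicalBarycenter_map_le hM hg)

end LawBarycenter

section Measurability

theorem stronglyMeasurable_of_dist_le_mul {α X Y : Type*} {mα : MeasurableSpace α}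
    [PseudoMetricSpace X] [MetricSpace Y] [MeasurableSpace X] [OpensMeasurableSpace X]
    [SecondCountableTopology X] {w : α → X} {f : α → Y} (hw : Measurable w) (C : NNReal)
    (h : ∀ a b, dist (f a) (f b) ≤ C * dist (w a) (w b)) : StronglyMeasurable f := by
  have lipschitz : LipschitzWith C (f ∘ Set.rangeSplitting w) := .of_dist_le_mul fun r s =>
    (h _ _).trans_eq (by simp only [Set.apply_rangeSplitting, Subtype.dist_eq])
  have factor : f = (f ∘ Set.rangeSplitting w) ∘ Set.rangeFactorization w := funext fun a =>
    dist_le_zero.1 ((h _ _).trans_eq (by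
      simp [Set.apply_rangeSplitting, Set.rangeFactorization]))
  rw [factor]
  exact lipschitz.continuous.comp_stronglyMeasurable
    (hw.subtype_mk (h := Set.mem_range_self)).stronglyMeasurable

theorem integral_eq_sum_of_ae_mem_finset {α : Type*} [MeasurableSpace α]
    [MeasurableSingletonClass α] {μ : Measure α} [IsFiniteMeasure μ] {s : Finset α}
    (hμ : ∀ᵐ x ∂μ, x ∈ s) (f : α → ℝ) : ∫ x, f x ∂μ = ∑ x ∈ s, μ.real {x} * f x := by
  rw [← setIntegral_eq_integral_of_ae_compl_eq_zero (s := s)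
    (hμ.mono fun x hx hxs => absurd hx hxs), setIntegral_finset s .finset]
  simp only [smul_eq_mul]

variable {M : Type*} [MetricSpace M] [MeasurableSpace M] [BorelSpace M] {s : Finset M}

theorem memLpMetric_id_of_ae_mem_finset [Nonempty M] {μ : Measure M} [IsFiniteMeasure μ]
    (hμ : ∀ᵐ x ∂μ, x ∈ s) : MemLpMetric inferInstance 1 μ id := by
  let x := Classical.arbitrary M
  refine ⟨aestronglyMeasurable_iff_aemeasurable_separable.2
    ⟨aemeasurable_id, s, s.countable_toSet.isSeparable, hμ⟩, x, ?_⟩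
  refine (MemLp.of_bound (f := dist x) (by fun_prop) (∑ y ∈ s, dist x y) (hμ.mono fun y hy => ?_)).2
  rw [Real.norm_of_nonneg dist_nonneg]
  exact Finset.single_le_sum (f := dist x) (fun _ _ => dist_nonneg) hy

variable [Nonempty M]

theorem dist_canonicalBarycenter_le_diam (hM : IsGlobalNPC M) {μ : Measure M}
    [IsProbabilityMeasure μ] (hμ : ∀ᵐ x ∂μ, x ∈ s) {y : M} (hy : y ∈ s) :
    dist (canonicalBarycenter μ) y ≤ Metric.diam (s : Set M) := by
  have hid := memLpMetric_id_of_ae_mem_finset hμ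
  have contraction := hid.dist_canonicalBarycenter_map_le hM (memLpMetric_const y)
  rw [Measure.map_id, Measure.map_const, measure_univ, one_smul, canonicalBarycenter_dirac hM]
    at contraction
  refine contraction.trans ((integral_mono_ae (hid.integrable_dist (memLpMetric_const y))
    (integrable_const (Metric.diam (s : Set M)))
    (hμ.mono fun x hx => Metric.dist_le_diam_of_mem s.finite_toSet.isBounded hx hy)).trans_eq ?_)
  simp

theorem dist_canonicalBarycenter_le_diam_mul_sum (hM : IsGlobalNPC M) {μ ν : Measure M}
    [IsProbabilityMeasure μ] [IsProbabilityMeasure ν] (hμ : ∀ᵐ x ∂μ, x ∈ s)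
    (hν : ∀ᵐ x ∂ν, x ∈ s) :
    dist (canonicalBarycenter μ) (canonicalBarycenter ν) ≤
      Metric.diam (s : Set M) * ∑ x ∈ s, |μ.real {x} - ν.real {x}| := by
  have hvμ := (memLpMetric_id_of_ae_mem_finset hμ).sq_dist_canonicalBarycenter_map_le hM
    (canonicalBarycenter ν)
  have hvν := (memLpMetric_id_of_ae_mem_finset hν).sq_dist_canonicalBarycenter_map_le hM
    (canonicalBarycenter μ)
  have haμ := fun x => dist_canonicalBarycenter_le_diam hM hμ (y := x)
  have hbν := fun x => dist_canonicalBarycenter_le_diam hM hν (y := x)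
  rw [Measure.map_id, integral_eq_sum_of_ae_mem_finset hμ] at hvμ
  rw [Measure.map_id, integral_eq_sum_of_ae_mem_finset hν] at hvν
  generalize canonicalBarycenter μ = a at *
  generalize canonicalBarycenter ν = b at *
  simp only [id_eq] at hvμ hvν
  have weighted_le (x : M) (hx : x ∈ s) :
      (μ.real {x} - ν.real {x}) * (dist b x ^ 2 - dist a x ^ 2) ≤
        2 * dist a b * (Metric.diam (s : Set M) * |μ.real {x} - ν.real {x}|) := calc
    _ ≤ |μ.real {x} - ν.real {x}| * |dist b x ^ 2 - dist a x ^ 2| :=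
      (le_abs_self _).trans_eq (abs_mul _ _)
    _ ≤ |μ.real {x} - ν.real {x}| *
        (dist b a * (Metric.diam (s : Set M) + Metric.diam (s : Set M))) := by
      gcongr
      refine (abs_sq_dist_sub_sq_dist_le b a x).trans ?_
      gcongr
      exacts [hbν x hx, haμ x hx]
    _ = _ := by rw [dist_comm b a]; ring
  have hsq : 2 * dist a b ^ 2 ≤
      2 * dist a b * (Metric.diam (s : Set M) * ∑ x ∈ s, |μ.real {x} - ν.real {x}|) := calc
    2 * dist a b ^ 2 ≤ ∑ x ∈ s, μ.real {x} * (dist b x ^ 2 - dist a x ^ 2) +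
        ∑ x ∈ s, ν.real {x} * (dist a x ^ 2 - dist b x ^ 2) := by
      linarith [dist_comm b a ▸ hvν]
    _ = ∑ x ∈ s, (μ.real {x} - ν.real {x}) * (dist b x ^ 2 - dist a x ^ 2) := by
      rw [← Finset.sum_add_distrib]
      exact Finset.sum_congr rfl fun x _ => by ring
    _ ≤ _ := by
      rw [Finset.mul_sum, Finset.mul_sum]
      exact Finset.sum_le_sum weighted_le
  exact le_of_sq_le_mul
    (mul_nonneg Metric.diam_nonneg (Finset.sum_nonneg fun _ _ => abs_nonneg _)) (by linarith)

theorem stronglyMeasurable_canonicalBarycenter_kernel (hM : IsGlobalNPC M) {α : Type*}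
    {mα : MeasurableSpace α} (κ : Kernel α M) [IsMarkovKernel κ] (hκ : ∀ a, ∀ᵐ x ∂κ a, x ∈ s) :
    StronglyMeasurable fun a => canonicalBarycenter (κ a) := by
  let w (a : α) (x : s) : ℝ := (κ a).real {x.1}
  have hw : Measurable w := measurable_pi_lambda _ fun x =>
    (κ.measurable_coe (measurableSet_singleton x.1)).ennreal_toReal
  refine stronglyMeasurable_of_dist_le_mul hw
    ((Metric.diam (s : Set M)).toNNReal * s.card) fun a b => ?_
  have sum_le : ∑ x ∈ s, |(κ a).real {x} - (κ b).real {x}| ≤ s.card * dist (w a) (w b) := by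
    rw [← Finset.sum_coe_sort]
    refine (Finset.sum_le_card_nsmul _ _ _ fun x _ => dist_le_pi_dist (w a) (w b) x).trans_eq ?_
    simp
  refine (dist_canonicalBarycenter_le_diam_mul_sum hM (hκ a) (hκ b)).trans ?_
  rw [NNReal.coe_mul, Real.coe_toNNReal _ Metric.diam_nonneg, NNReal.coe_natCast, mul_assoc]
  exact mul_le_mul_of_nonneg_left sum_le Metric.diam_nonneg

end Measurability

section CondExpKernel

variable {Ω : Type*} {𝓑 : MeasurableSpace Ω} [mΩ : MeasurableSpace Ω] [StandardBorelSpace Ω]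
  {P : Measure[mΩ] Ω} [IsFiniteMeasure P]

theorem ae_ae_condExpKernel (h𝓑 : 𝓑 ≤ mΩ) {p : Ω → Prop} (hp : ∀ᵐ ω ∂P, p ω) :
    ∀ᵐ ω ∂P, ∀ᵐ ω' ∂condExpKernel P 𝓑 ω, p ω' :=
  ae_of_ae_trim h𝓑 (Measure.ae_ae_of_ae_comp (by rwa [condExpKernel_comp_trim h𝓑]))

theorem ae_condExpKernel_eq {X : Type*} [TopologicalSpace X] [TopologicalSpace.MetrizableSpace X]
    (h𝓑 : 𝓑 ≤ mΩ) {ψ : Ω → X} (hψ : AEStronglyMeasurable[𝓑] ψ P) :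
    ∀ᵐ ω ∂P, ∀ᵐ ω' ∂condExpKernel P 𝓑 ω, ψ ω' = ψ ω := by
  obtain ⟨g, hg, hgψ⟩ := hψ
  have fibre : ∀ᵐ ω ∂P, ∀ᵐ ω' ∂condExpKernel P 𝓑 ω, g ω' = g ω := by
    refine ae_of_ae_trim h𝓑 (Measure.ae_ae_of_ae_compProd (p := fun x => g x.2 = g x.1) ?_)
    have measurable_diag : Measurable[mΩ, 𝓑.prod mΩ] (Function.diag : Ω → Ω × Ω) :=
      (measurable_id'' h𝓑).prod measurable_id
    have measurable_fst_comp : StronglyMeasurable[𝓑.prod mΩ] fun x : Ω × Ω => g x.1 :=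
      hg.comp_measurable measurable_fst
    have measurable_snd_comp : StronglyMeasurable[𝓑.prod mΩ] fun x : Ω × Ω => g x.2 :=
      (hg.mono h𝓑).comp_measurable measurable_snd
    rw [compProd_trim_condExpKernel h𝓑]
    exact (ae_map_iff ⟨_, measurable_diag, ae_eq_rfl⟩
      (measurable_snd_comp.measurableSet_eq_fun measurable_fst_comp)).2 (ae_of_all _ fun _ => rfl)
  filter_upwards [fibre, ae_ae_condExpKernel h𝓑 hgψ, hgψ] with ω hω hω_fibre hω_base
  filter_upwards [hω, hω_fibre] with ω' hg hg'
  rw [hg', hg, hω_base]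

theorem MemLpMetric.ae_condExpKernel {M : Type*} [MetricSpace M] {φ : Ω → M} (h𝓑 : 𝓑 ≤ mΩ)
    (h : MemLpMetric mΩ 1 P φ) : ∀ᵐ ω ∂P, MemLpMetric mΩ 1 (condExpKernel P 𝓑 ω) φ := by
  obtain ⟨g, hg, hφg⟩ := h.1
  obtain ⟨x, -⟩ := h.2
  filter_upwards [ae_ae_condExpKernel h𝓑 hφg,
    (h.integrable_dist_const x).condExpKernel_ae (m := 𝓑)] with ω hω hx
  exact ⟨⟨g, hg, hω⟩, x, (memLp_one_iff_integrable.2 hx).2⟩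

theorem integral_integral_condExpKernel (h𝓑 : 𝓑 ≤ mΩ) {f : Ω → ℝ} (hf : Integrable f P) :
    ∫ ω, ∫ ω', f ω' ∂condExpKernel P 𝓑 ω ∂P = ∫ ω, f ω ∂P := by
  rw [← integral_condExp h𝓑 (f := f)]
  exact integral_congr_ae (condExp_ae_eq_integral_condExpKernel h𝓑 hf).symm

end CondExpKernel

section BarycentricCondExp

variable {Ω M : Type*} {𝓑 : MeasurableSpace Ω} [mΩ : MeasurableSpace Ω] [StandardBorelSpace Ω]
  {P : Measure[mΩ] Ω} [IsFiniteMeasure P] [MetricSpace M] [MeasurableSpace M] [Nonempty M]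
  {p : ℝ≥0∞} {φ ψ : Ω → M}

theorem barycentricCondExp_congr_ae (h𝓑 : 𝓑 ≤ mΩ) (h : φ =ᵐ[P] ψ) :
    barycentricCondExp 𝓑 P φ =ᵐ[P] barycentricCondExp 𝓑 P ψ := by
  filter_upwards [ae_ae_condExpKernel h𝓑 h] with ω hω
  simp only [barycentricCondExp, Measure.map_congr hω]

variable [BorelSpace M]

theorem barycentricCondExp_const (hM : IsGlobalNPC M) (x : M) :
    barycentricCondExp 𝓑 P (fun _ => x) = fun _ => x := by
  funext ω
  rw [barycentricCondExp, Measure.map_const, measure_univ, one_smul, canonicalBarycenter_dirac hM]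

theorem stronglyMeasurable_barycentricCondExp_simpleFunc (hM : IsGlobalNPC M)
    (φ : SimpleFunc Ω M) : StronglyMeasurable[𝓑] (barycentricCondExp 𝓑 P φ) := by
  have := Kernel.IsMarkovKernel.map (condExpKernel P 𝓑) φ.measurable
  have ae_mem_range (ω : Ω) : ∀ᵐ x ∂(condExpKernel P 𝓑).map φ ω, x ∈ φ.range := by
    rw [Kernel.map_apply _ φ.measurable]
    exact (ae_map_iff (p := (· ∈ φ.range)) φ.aemeasurable φ.range.measurableSet).2
      (ae_of_all _ φ.mem_range_self)
  convert stronglyMeasurable_canonicalBarycenter_kernel hM ((condExpKernel P 𝓑).map φ)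
    ae_mem_range using 2 with ω
  rw [Kernel.map_apply _ φ.measurable, barycentricCondExp]

namespace MemLpMetric

theorem distLp_barycentricCondExp_le (hM : IsGlobalNPC M) (h𝓑 : 𝓑 ≤ mΩ) (hp : 1 ≤ p)
    (hφ : MemLpMetric mΩ 1 P φ) (hψ : MemLpMetric mΩ 1 P ψ) :
    distLp p P (barycentricCondExp 𝓑 P φ) (barycentricCondExp 𝓑 P ψ) ≤ distLp p P φ ψ := by
  refine (eLpNorm_mono_ae_real ?_).trans (eLpNorm_condExp_le_eLpNorm (m := 𝓑) _ hp)
  filter_upwards [hφ.ae_condExpKernel h𝓑, hψ.ae_condExpKernel h𝓑,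
    condExp_ae_eq_integral_condExpKernel h𝓑 (hφ.integrable_dist hψ)] with ω hφω hψω condExp_eq
  rw [condExp_eq, Real.norm_of_nonneg dist_nonneg]
  exact hφω.dist_canonicalBarycenter_map_le hM hψω

theorem aestronglyMeasurable_barycentricCondExp (hM : IsGlobalNPC M) (h𝓑 : 𝓑 ≤ mΩ)
    (h : MemLpMetric mΩ 1 P φ) : AEStronglyMeasurable[𝓑] (barycentricCondExp 𝓑 P φ) P := by
  obtain ⟨g, hg, hφg⟩ := h.1
  obtain ⟨gs, hgs⟩ := exists_simpleFunc_tendsto_distLp_one hg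
  have := hM.complete
  have measurable_lim : StronglyMeasurable[𝓑] fun ω =>
      limUnder atTop fun n => barycentricCondExp 𝓑 P (gs n) ω :=
    @StronglyMeasurable.limUnder _ _ _ 𝓑 _ _ _ _ _ _ _ fun n =>
      stronglyMeasurable_barycentricCondExp_simpleFunc hM (gs n)
  refine .congr ⟨_, measurable_lim, ?_⟩ (barycentricCondExp_congr_ae h𝓑 hφg.symm)
  filter_upwards [(h.congr_ae hφg).ae_condExpKernel h𝓑] with ω hω
  refine (Tendsto.limUnder_eq (tendsto_iff_edist_tendsto_0.2 ?_)).symm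
  exact tendsto_of_tendsto_of_tendsto_of_le_of_le tendsto_const_nhds
    (hgs (condExpKernel P 𝓑 ω) inferInstance hω) (fun _ => zero_le) fun n =>
      (memLpMetric_simpleFunc (gs n)).edist_canonicalBarycenter_map_le hM hω

protected theorem barycentricCondExp (hM : IsGlobalNPC M) (h𝓑 : 𝓑 ≤ mΩ) (hp : 1 ≤ p)
    (h : MemLpMetric mΩ p P φ) : MemLpMetric 𝓑 p P (barycentricCondExp 𝓑 P φ) := by
  obtain ⟨x, hx⟩ := h.2
  refine ⟨(h.mono_exponent hp).aestronglyMeasurable_barycentricCondExp hM h𝓑, x, ?_⟩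
  rw [← barycentricCondExp_const (P := P) (𝓑 := 𝓑) hM x]
  exact ((memLpMetric_const x).distLp_barycentricCondExp_le hM h𝓑 hp (h.mono_exponent hp)).trans_lt
    hx

theorem distLp_two_barycentricCondExp_sq_add_sq_le (hM : IsGlobalNPC M) (h𝓑 : 𝓑 ≤ mΩ)
    (hφ : MemLpMetric mΩ 2 P φ) (hψ : MemLpMetric 𝓑 2 P ψ) :
    distLp 2 P (barycentricCondExp 𝓑 P φ) ψ ^ 2 +
      distLp 2 P φ (barycentricCondExp 𝓑 P φ) ^ 2 ≤ distLp 2 P φ ψ ^ 2 := by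
  have hE := hφ.barycentricCondExp hM h𝓑 one_le_two
  have hEψ := (hE.of_le h𝓑).memLp_dist (hψ.of_le h𝓑)
  have hφE := hφ.memLp_dist (hE.of_le h𝓑)
  have hφψ := hφ.memLp_dist (hψ.of_le h𝓑)
  have integrable_sub : Integrable (fun ω => dist (φ ω) (ψ ω) ^ 2 -
      dist (φ ω) (barycentricCondExp 𝓑 P φ ω) ^ 2) P :=
    hφψ.integrable_sq.sub hφE.integrable_sq
  have variance_ineq : ∫ ω, dist (barycentricCondExp 𝓑 P φ ω) (ψ ω) ^ 2 ∂P ≤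
      ∫ ω, dist (φ ω) (ψ ω) ^ 2 ∂P -
        ∫ ω, dist (φ ω) (barycentricCondExp 𝓑 P φ ω) ^ 2 ∂P := by
    rw [← integral_sub hφψ.integrable_sq hφE.integrable_sq,
      ← integral_integral_condExpKernel h𝓑 integrable_sub]
    refine integral_mono_ae hEψ.integrable_sq integrable_sub.integral_condExpKernel ?_
    filter_upwards [(hφ.mono_exponent one_le_two).ae_condExpKernel h𝓑,
      ae_condExpKernel_eq h𝓑 hψ.1, ae_condExpKernel_eq h𝓑 hE.1] with ω hφω hψω hEω
    refine (hφω.sq_dist_canonicalBarycenter_map_le hM (ψ ω)).trans_eq (integral_congr_ae ?_)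
    filter_upwards [hψω, hEω] with ω' hψω' hEω'
    rw [hψω', hEω', dist_comm (φ ω'), dist_comm (φ ω')]
    rfl
  rw [distLp_two_sq hEψ, distLp_two_sq hφE, distLp_two_sq hφψ,
    ← ENNReal.ofReal_add (integral_nonneg fun _ => sq_nonneg _)
      (integral_nonneg fun _ => sq_nonneg _)]
  exact ENNReal.ofReal_le_ofReal (le_sub_iff_add_le.1 variance_ineq)

end MemLpMetric

end BarycentricCondExp

section SturmCondExp

variable {Ω M : Type*} {𝓑 : MeasurableSpace Ω} [mΩ : MeasurableSpace Ω] [StandardBorelSpace Ω]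
  {P : Measure[mΩ] Ω} [IsFiniteMeasure P] [MetricSpace M] [MeasurableSpace M] [BorelSpace M]
  [Nonempty M] {φ : Ω → M} {E : (Ω → M) → (Ω → M)}

theorem isSturmCondExp_barycentricCondExp (hM : IsGlobalNPC M) (h𝓑 : 𝓑 ≤ mΩ) :
    IsSturmCondExp 𝓑 P (barycentricCondExp 𝓑 P : (Ω → M) → (Ω → M)) where
  mapsTo _ hφ := hφ.barycentricCondExp hM h𝓑 le_rfl
  continuous _ _ hφ hφs lim :=
    tendsto_of_tendsto_of_tendsto_of_le_of_le tendsto_const_nhds lim (fun _ => zero_le)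
      fun k => (hφs k).distLp_barycentricCondExp_le hM h𝓑 le_rfl hφ
  argmin _ hφ :=
    ⟨hφ.barycentricCondExp hM h𝓑 one_le_two, fun _ hψ =>
      (ENNReal.pow_le_pow_left_iff two_ne_zero).1 (le_add_self.trans
        (hφ.distLp_two_barycentricCondExp_sq_add_sq_le hM h𝓑 hψ))⟩

namespace IsSturmCondExp

theorem ae_eq_barycentricCondExp_of_memLpMetric_two (hM : IsGlobalNPC M) (h𝓑 : 𝓑 ≤ mΩ)
    (hE : IsSturmCondExp 𝓑 P E) (hφ : MemLpMetric mΩ 2 P φ) :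
    E φ =ᵐ[P] barycentricCondExp 𝓑 P φ := by
  have hB := hφ.barycentricCondExp hM h𝓑 one_le_two
  obtain ⟨hEφ, hmin⟩ := hE.argmin _ hφ
  have finite : distLp 2 P φ (barycentricCondExp 𝓑 P φ) ^ 2 ≠ ∞ :=
    ENNReal.pow_ne_top (hφ.memLp_dist (hB.of_le h𝓑)).2.ne
  have sq_eq_zero : distLp 2 P (barycentricCondExp 𝓑 P φ) (E φ) ^ 2 = 0 := by
    refine nonpos_iff_eq_zero.1 ((ENNReal.add_le_add_iff_right finite).1 ?_)
    rw [zero_add]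
    exact (hφ.distLp_two_barycentricCondExp_sq_add_sq_le hM h𝓑 hEφ).trans
      (pow_le_pow_left₀ zero_le (hmin _ hB) 2)
  exact (ae_eq_of_distLp_eq_zero two_ne_zero (hB.of_le h𝓑).1 (hEφ.of_le h𝓑).1
    (pow_eq_zero_iff two_ne_zero |>.1 sq_eq_zero)).symm

theorem ae_eq_barycentricCondExp (hM : IsGlobalNPC M) (h𝓑 : 𝓑 ≤ mΩ)
    (hE : IsSturmCondExp 𝓑 P E) (hφ : MemLpMetric mΩ 1 P φ) :
    E φ =ᵐ[P] barycentricCondExp 𝓑 P φ := by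
  obtain ⟨g, hg, hφg⟩ := hφ.1
  obtain ⟨φs, hφs⟩ := exists_simpleFunc_tendsto_distLp_one hg
  have lim : Tendsto (fun n => distLp 1 P (φs n) φ) atTop (𝓝 0) :=
    (hφs P inferInstance (hφ.congr_ae hφg)).congr fun n => distLp_congr_ae ae_eq_rfl hφg.symm
  have memLp_φs (p : ℝ≥0∞) (n : ℕ) : MemLpMetric mΩ p P (φs n) := memLpMetric_simpleFunc (φs n)
  have hB := isSturmCondExp_barycentricCondExp (P := P) (M := M) hM h𝓑
  have limE := hE.continuous φ (fun n => φs n) hφ (memLp_φs 1) lim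
  have limB := hB.continuous φ (fun n => φs n) hφ (memLp_φs 1) lim
  have hEφ := ((hE.mapsTo φ hφ).of_le h𝓑).1
  have hBφ := ((hB.mapsTo φ hφ).of_le h𝓑).1
  refine ae_eq_of_distLp_eq_zero one_ne_zero hEφ hBφ (nonpos_iff_eq_zero.1 ?_)
  refine ge_of_tendsto' ((limE.add limB).trans_eq (by rw [add_zero])) fun n => ?_
  have agree := hE.ae_eq_barycentricCondExp_of_memLpMetric_two hM h𝓑 (memLp_φs 2 n)
  rw [← distLp_congr_ae agree ae_eq_rfl, distLp_comm (E (φs n)) (E φ)]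
  exact distLp_triangle le_rfl hEφ ((hE.mapsTo _ (memLp_φs 1 n)).of_le h𝓑).1 hBφ

end IsSturmCondExp

end SturmCondExp

theorem theorem2p13_general {Ω M : Type*} (𝓑 : MeasurableSpace Ω) [mΩ : MeasurableSpace Ω]
    [StandardBorelSpace Ω] (h𝓑 : 𝓑 ≤ mΩ) (P : Measure[mΩ] Ω) [IsFiniteMeasure P]
    [MetricSpace M] [Nonempty M] [MeasurableSpace M] [BorelSpace M] (hM : IsGlobalNPC M) :
    (∀ (μ : Measure M) [IsProbabilityMeasure μ], (∃ x : M, Integrable (fun y => dist x y) μ) →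
      ∃! z : M, IsCanonicalBarycenter μ z) ∧
    IsSturmCondExp 𝓑 P (sturmCondExp 𝓑 P : (Ω → M) → (Ω → M)) ∧
    (∀ E : (Ω → M) → (Ω → M), IsSturmCondExp 𝓑 P E →
      ∀ φ : Ω → M, MemLpMetric mΩ 1 P φ → E φ =ᵐ[P] sturmCondExp 𝓑 P φ) ∧
    ∀ p : ℝ≥0∞, 1 ≤ p → ∀ φ : Ω → M, MemLpMetric mΩ p P φ →
      (∀ᵐ ω ∂P, MemP1 (Measure.map φ (condExpKernel P 𝓑 ω))) ∧
      MemLpMetric 𝓑 p P (barycentricCondExp 𝓑 P φ) ∧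
      sturmCondExp 𝓑 P φ =ᵐ[P] barycentricCondExp 𝓑 P φ := by
  have hS : IsSturmCondExp 𝓑 P (sturmCondExp 𝓑 P : (Ω → M) → (Ω → M)) :=
    Classical.epsilon_spec (p := IsSturmCondExp 𝓑 P)
      ⟨_, isSturmCondExp_barycentricCondExp hM h𝓑⟩
  refine ⟨fun μ _ ⟨x, hx⟩ => existsUnique_isCanonicalBarycenter hM hx, hS,
    fun E hE φ hφ => ?_, fun p hp φ hφ => ?_⟩
  · exact (hE.ae_eq_barycentricCondExp hM h𝓑 hφ).trans
      (hS.ae_eq_barycentricCondExp hM h𝓑 hφ).symm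
  · have hφ_one := hφ.mono_exponent hp
    exact ⟨(hφ_one.ae_condExpKernel h𝓑).mono fun _ hφω => hφω.memP1_map,
      hφ.barycentricCondExp hM h𝓑 hp, hS.ae_eq_barycentricCondExp hM h𝓑 hφ_one⟩

theorem theorem2p13 {Ω M : Type*} (𝓑 : MeasurableSpace Ω) [mΩ : MeasurableSpace Ω]
    [StandardBorelSpace Ω] (h𝓑 : 𝓑 ≤ mΩ) (P : Measure[mΩ] Ω) [IsProbabilityMeasure P]
    [MetricSpace M] [Nonempty M] [MeasurableSpace M] [BorelSpace M] (hM : IsGlobalNPC M) :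
    -- the canonical barycentric map is well defined on `𝒫¹(M)`
    (∀ μ : Measure M, MemP1 μ → ∃! z : M, IsCanonicalBarycenter μ z) ∧
    -- Sturm's conditional expectation exists and is unique up to null sets
    IsSturmCondExp 𝓑 P (sturmCondExp 𝓑 P : (Ω → M) → (Ω → M)) ∧
    (∀ E : (Ω → M) → (Ω → M), IsSturmCondExp 𝓑 P E →
      ∀ φ : Ω → M, MemLpMetric mΩ 1 P φ → E φ =ᵐ[P] sturmCondExp 𝓑 P φ) ∧
    -- the two conditional expectations coincide, in `L^p(Ω, 𝓑, P; M)`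
    ∀ p : ℝ≥0∞, 1 ≤ p → ∀ φ : Ω → M, MemLpMetric mΩ p P φ →
      (∀ᵐ ω ∂P, MemP1 (Measure.map φ (condExpKernel P 𝓑 ω))) ∧
      MemLpMetric 𝓑 p P (barycentricCondExp 𝓑 P φ) ∧
      sturmCondExp 𝓑 P φ =ᵐ[P] barycentricCondExp 𝓑 P φ := by
  have h := theorem2p13_general 𝓑 h𝓑 P hM
  exact ⟨fun μ hμ => have := hμ.prob; h.1 μ hμ.integrable_dist, h.2⟩
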